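/- Let $G=(V,E)$ be a finite simple connected graph on $n$ vertices and let $T$ be a spanning tree of $G$. A partial orientation $\sigma$ of $G$ with respect to $T$ leaves the edges of $T$ undirected and orients each of the other edges of $G$; it is encoded by a skew-symmetric sign map with $\sigma(u,v)=1=-\sigma(v,u)$ if the edge $\{u,v\}\in E\setminus E(T)$ is oriented from $u$ to $v$. The Hermitian adjacency matrix $H(G_T^\sigma)=(h_{uv})_{u,v\in V}$ of the resulting mixed graph $G_T^\sigma$ has $h_{uv}=1$ if $\{u,v\}\in E(T)$, $h_{uv}=\mathrm{i}\,\sigma(u,v)$ if $\{u,v\}\in E\setminus E(T)$, and $h_{uv}=0$ otherwise; let $\lambda_{\max}(G_T^\sigma)$ be its largest eigenvalue. Let $\mu_G(x)=\sum_{0\le k\le n/2}(-1)^k m_k(G)\,x^{n-2k}$ be the matching polynomial of $G$, where $m_k(G)$ is the number of sets of $k$ pairwise disjoint edges of $G$ (so $m_0(G)=1$), and let $\rho(\mu_G)$ be the largest absolute value of the complex roots of $\mu_G$. Then $\rho(\mu_G)$ is also the largest real root of $\mu_G$, and there exists a partial orientation $\sigma$ of $G$ with respect to $T$ such that $$\lambda_{\max}(G_T^\sigma)\le\rho(\mu_G).$$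 -/

import Mathlib

/-- An orientation `σ` of the graph `G` with respect to a set `F` of edges that stay undirected.
Every edge of `G` outside `F` gets a direction: `σ u v = 1` means that the edge `{u, v}` is
oriented from `u` to `v`, and `σ u v = -1` that it is oriented from `v` to `u`. The map is
extended by `0` to the pairs in `F`. -/
structure PartialOrientation {V : Type*} (G : SimpleGraph V) (F : Set (Sym2 V)) where
  sign : V → V → SignType
  skew : ∀ u v, sign u v = -sign v u
  ne_zero_iff : ∀ u v, sign u v ≠ 0 ↔ s(u, v) ∈ G.edgeSet \ F

open Classical in
/-- The Hermitian adjacency matrix of the mixed graph obtained from `G` by leaving the edges in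
`F` undirected and orienting all other edges by `σ`. -/
noncomputable def hermitianAdjMatrix {V : Type*} {G : SimpleGraph V} {F : Set (Sym2 V)}
    (σ : PartialOrientation G F) : Matrix V V ℂ :=
  Matrix.of fun u v =>
    if s(u, v) ∈ F then 1
    else if s(u, v) ∈ G.edgeSet then Complex.I * ((σ.sign u v : SignType) : ℂ)
    else 0

theorem hermitianAdjMatrix_isHermitian {V : Type*} {G : SimpleGraph V} {F : Set (Sym2 V)}
    (σ : PartialOrientation G F) : (hermitianAdjMatrix σ).IsHermitian := by
  ext u v
  have hs : s(v, u) = s(u, v) := Sym2.eq_swap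
  simp only [hermitianAdjMatrix, Matrix.conjTranspose_apply, Matrix.of_apply, σ.skew v u]
  by_cases h1 : s(u, v) ∈ F
  · simp [h1, hs]
  · by_cases h2 : s(u, v) ∈ G.edgeSet
    · simp only [hs, h1, h2, if_true, if_false]
      cases σ.sign u v <;> simp
    · simp only [hs, h1, h2, if_false, star_zero]

/-- The real eigenvalues of a complex square matrix (for a Hermitian matrix: all eigenvalues). -/
def realEigenvalues {V : Type*} [Fintype V] [DecidableEq V] (A : Matrix V V ℂ) : Set ℝ :=
  {x : ℝ | Module.End.HasEigenvalue (Matrix.toLin' A) (x : ℂ)}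

open Classical in
/-- The number of matchings of `G` with exactly `k` edges; a matching is a set of edges of `G`
of which no two distinct ones share a vertex. -/
noncomputable def matchingCount {V : Type*} [Fintype V] (G : SimpleGraph V) (k : ℕ) : ℕ :=
  (Finset.univ.filter fun M : Finset (Sym2 V) =>
    M.card = k ∧ (∀ e ∈ M, e ∈ G.edgeSet) ∧
      ∀ e ∈ M, ∀ f ∈ M, e ≠ f → ∀ v, v ∈ e → v ∉ f).card

/-- The matching polynomial `∑ₖ (-1)ᵏ mₖ(G) x ^ (n - 2k)` of a graph `G` with `n` vertices. A
matching has at most `n / 2` edges, so `k` runs over `0 ≤ k ≤ n / 2`. -/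
noncomputable def matchingPolynomial {V : Type*} [Fintype V] (G : SimpleGraph V) :
    Polynomial ℝ :=
  ∑ k ∈ Finset.range (Fintype.card V / 2 + 1),
    Polynomial.C ((-1 : ℝ) ^ k * (matchingCount G k : ℝ)) *
      Polynomial.X ^ (Fintype.card V - 2 * k)

/-! The proof is the method of interlacing families. Up to a fixed Hermitian matrix
`undirectedPart`, the matrix of an orientation is a sum of rank one matrices `v vᴴ`, one for each
non-tree edge. The direction of an edge only selects one of two vectors
(`hermitianAdjMatrix_signedOrientation`).

Averaging `det (x - H)` over all orientations gives the matching polynomial. In the Leibniz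
expansion, a permutation with a cycle of length at least three along edges uses a non-tree edge on
it, because `T` is acyclic. Reversing that edge negates the term, so these permutations cancel.
Involutions along edges are matchings, and one with `k` transpositions contributes `(-1)ᵏ x ^ (n -
2k)`.

Partial averages of the determinant stay nonzero on matrices with positive definite imaginary part
(`isDetLike_averageDet`). So the averaged polynomials are real-rooted, and subtracting `v vᴴ` gives
a quotient mapping the upper half-plane to its closure. Hence fixing the direction of one edge
suitably keeps all real roots below the bound (`forall_root_le_or_of_add`), and the directions are
fixed one by one. The parity of the matching polynomial identifies its largest root with its largest
absolute value. -/

/-! ### Real polynomials whose quotient preserves the upper half-plane -/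

open Polynomial in
theorem Polynomial.Monic.exists_root_ge_of_eval_nonpos {p : ℝ[X]} (hp : p.Monic) {a : ℝ}
    (ha : p.eval a ≤ 0) : ∃ x, a ≤ x ∧ p.eval x = 0 := by
  have hdeg : 0 < p.degree := by
    by_contra h
    rw [← natDegree_pos_iff_degree_pos, not_lt, Nat.le_zero, hp.natDegree_eq_zero] at h
    rw [h, eval_one] at ha
    linarith
  have ht := p.tendsto_atTop_of_leadingCoeff_nonneg hdeg (by simp [hp.leadingCoeff])
  obtain ⟨b, hb0, hab⟩ := ((ht.eventually_ge_atTop 0).and (Filter.eventually_ge_atTop a)).exists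
  obtain ⟨x, hx, hx0⟩ := intermediate_value_Icc hab p.continuous.continuousOn ⟨ha, hb0⟩
  exact ⟨x, hx.1, hx0⟩

open Polynomial in
theorem Polynomial.Monic.eval_pos_of_forall_root_le {p : ℝ[X]} (hp : p.Monic) {r : ℝ}
    (h : ∀ x, r < x → p.eval x ≠ 0) {x : ℝ} (hx : r < x) : 0 < p.eval x := by
  by_contra hneg
  obtain ⟨y, hy, hy0⟩ := hp.exists_root_ge_of_eval_nonpos (not_lt.1 hneg)
  exact h y (hx.trans_le hy) hy0

open Polynomial in
/-- If `f / p` maps the upper half-plane to its closure, then the Wronskian of `p` and `f` is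
nonnegative on the real line. -/
theorem wronskian_nonneg_of_im_div_nonneg {p f : ℝ[X]}
    (h : ∀ z : ℂ, 0 < z.im → 0 ≤ (aeval z f / aeval z p).im) (x : ℝ) :
    0 ≤ (derivative f).eval x * p.eval x - f.eval x * (derivative p).eval x := by
  have key : ∀ q : ℝ[X], HasDerivAt (fun y : ℝ => aeval ((x : ℂ) + y * Complex.I) q)
      (((derivative q).eval x : ℝ) * Complex.I) 0 := by
    intro q
    have h1 : HasDerivAt (fun y : ℝ => (x : ℂ) + y * Complex.I) Complex.I 0 := by
      simpa using ((Complex.ofRealCLM.hasDerivAt (x := 0)).mul_const Complex.I).const_add (x : ℂ)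
    have h2 := (q.hasDerivAt_aeval ((x : ℂ) + ((0 : ℝ) : ℂ) * Complex.I)).comp (0 : ℝ) h1
    have h3 : aeval (x : ℂ) (derivative q) = (((derivative q).eval x : ℝ) : ℂ) := by
      simpa using aeval_algebraMap_apply ℂ x (derivative q)
    simpa [Function.comp_def, h3] using h2
  have hreal : ∀ q : ℝ[X], aeval (x : ℂ) q = ((q.eval x : ℝ) : ℂ) := fun q => by
    simpa using aeval_algebraMap_apply ℂ x q
  -- `ψ y` is `Im (f / p)` times `|p|²` at `x + iy`. It vanishes at `0`, is nonnegative for `y > 0`,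
  -- and has the Wronskian as its derivative at `0`.
  let ψ : ℝ → ℝ := fun y =>
    (aeval ((x : ℂ) + y * Complex.I) f * star (aeval ((x : ℂ) + y * Complex.I) p)).im
  have hψ : HasDerivAt ψ
      ((derivative f).eval x * p.eval x - f.eval x * (derivative p).eval x) 0 := by
    have h1 := Complex.imCLM.hasFDerivAt.comp_hasDerivAt (0 : ℝ) ((key f).mul (key p).star)
    simp only [Complex.ofReal_zero, zero_mul, add_zero, hreal] at h1
    refine HasDerivAt.congr_deriv (f := ψ) h1 ?_
    simp
    ring
  have h0 : ψ 0 = 0 := by simp [ψ, hreal]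
  have hpos : ∀ y : ℝ, 0 < y → 0 ≤ ψ y := by
    intro y hy
    set z : ℂ := (x : ℂ) + y * Complex.I
    have hz := h z (by simp [z, hy])
    by_cases hp : aeval z p = 0
    · simp [ψ, z, hp]
    have : ψ y = (aeval z f / aeval z p).im * Complex.normSq (aeval z p) := by
      have : aeval z f * star (aeval z p) =
          (aeval z f / aeval z p) * (Complex.normSq (aeval z p) : ℝ) := by
        rw [Complex.normSq_eq_conj_mul_self]
        field_simp
        rfl
      simp only [ψ]
      rw [this, Complex.im_mul_ofReal]
    rw [this]
    exact mul_nonneg hz (Complex.normSq_nonneg _)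
  have hslope := (hasDerivWithinAt_iff_tendsto_slope' (by simp)).1
    (hψ.hasDerivWithinAt (s := Set.Ioi 0))
  refine ge_of_tendsto hslope ?_
  filter_upwards [self_mem_nhdsWithin] with y hy
  rw [slope_def_field, h0]
  exact div_nonneg (by simpa using hpos y hy) (by simpa using le_of_lt hy)

open Polynomial in
theorem monotoneOn_div_of_im_div_nonneg {p f : ℝ[X]} {r : ℝ}
    (h : ∀ z : ℂ, 0 < z.im → 0 ≤ (aeval z f / aeval z p).im)
    (hp : ∀ x, r < x → p.eval x ≠ 0) :
    MonotoneOn (fun x => f.eval x / p.eval x) (Set.Ioi r) := by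
  have hd : ∀ x ∈ Set.Ioi r, HasDerivAt (fun x => f.eval x / p.eval x)
      (((derivative f).eval x * p.eval x - f.eval x * (derivative p).eval x) / p.eval x ^ 2) x :=
    fun x hx => (f.hasDerivAt x).div (p.hasDerivAt x) (hp x hx)
  refine monotoneOn_of_deriv_nonneg (convex_Ioi r)
    (fun x hx => (hd x hx).continuousAt.continuousWithinAt) ?_ ?_
  · rw [interior_Ioi]
    exact fun x hx => (hd x hx).differentiableAt.differentiableWithinAt
  · rw [interior_Ioi]
    intro x hx
    rw [(hd x hx).deriv]
    exact div_nonneg (wronskian_nonneg_of_im_div_nonneg h x) (sq_nonneg _)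

-- Beyond the largest root `a` of `p`, the quotient `f / p` is monotone with limit `1`, so `f ≤ p`
-- there; then let `x` tend to `a`.
open Polynomial in
theorem eval_nonpos_of_root_of_im_div_nonneg {p f : ℝ[X]} (hp : p.Monic) (hf : f.Monic)
    (hdeg : f.natDegree = p.natDegree)
    (h : ∀ z : ℂ, 0 < z.im → 0 ≤ (aeval z f / aeval z p).im) {a : ℝ} (ha : p.eval a = 0)
    (hmax : ∀ x, a < x → p.eval x ≠ 0) : f.eval a ≤ 0 := by
  have hmono := monotoneOn_div_of_im_div_nonneg h hmax
  have hlim : Filter.Tendsto (fun x => f.eval x / p.eval x) Filter.atTop (nhds 1) := by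
    have := f.div_tendsto_atTop_leadingCoeff_div_of_degree_eq p
      (by rw [degree_eq_natDegree hf.ne_zero, degree_eq_natDegree hp.ne_zero, hdeg])
    simpa [hp.leadingCoeff, hf.leadingCoeff] using this
  have hle : ∀ x, a < x → f.eval x ≤ p.eval x := by
    intro x hx
    have : f.eval x / p.eval x ≤ 1 := ge_of_tendsto hlim <| by
      filter_upwards [Filter.eventually_ge_atTop x] with y hy
      exact hmono hx (hx.trans_le hy) hy
    rwa [div_le_one (hp.eval_pos_of_forall_root_le hmax hx)] at this
  rw [← ha]
  have h1 : Filter.Tendsto (fun x => f.eval x) (nhdsWithin a (Set.Ioi a)) (nhds (f.eval a)) :=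
    f.continuous.continuousAt.continuousWithinAt
  have h2 : Filter.Tendsto (fun x => p.eval x) (nhdsWithin a (Set.Ioi a)) (nhds (p.eval a)) :=
    p.continuous.continuousAt.continuousWithinAt
  exact le_of_tendsto_of_tendsto h1 h2
    (by filter_upwards [self_mem_nhdsWithin] with x hx using hle x hx)

open Polynomial in
/-- Let `p`, `f`, `g` be monic real polynomials of the same degree such that `f / p` and `g / p`
map the upper half-plane to its closure. If all real roots of `f + g` are at most `r`, then the
same holds for `f` or for `g`. -/
theorem forall_root_le_or_of_add {p f g : ℝ[X]} (hp : p.Monic) (hf : f.Monic) (hg : g.Monic)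
    (hfp : f.natDegree = p.natDegree) (hgp : g.natDegree = p.natDegree)
    (hfi : ∀ z : ℂ, 0 < z.im → 0 ≤ (aeval z f / aeval z p).im)
    (hgi : ∀ z : ℂ, 0 < z.im → 0 ≤ (aeval z g / aeval z p).im) {r : ℝ}
    {h : ℝ[X]} (hh : h.Monic) (hsum : ∀ x, f.eval x + g.eval x = 2 * h.eval x)
    (hr : ∀ x, r < x → h.eval x ≠ 0) :
    (∀ x, r < x → f.eval x ≠ 0) ∨ (∀ x, r < x → g.eval x ≠ 0) := by
  -- At the largest root `a` of `p`, both `f` and `g` are nonpositive, hence so is `h`. A root `a >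
  -- r` would thus force a root of `h` beyond `r`.
  have hpr : ∀ x, r < x → p.eval x ≠ 0 := by
    intro x hx hx0
    have hmem : x ∈ p.roots.toFinset := by simp [hp.ne_zero, hx0]
    obtain ⟨a, ha, hmax⟩ := p.roots.toFinset.exists_max_image id ⟨x, hmem⟩
    have ha0 : p.eval a = 0 := by simpa [hp.ne_zero] using ha
    have hmax' : ∀ y, a < y → p.eval y ≠ 0 := fun y hy hy0 =>
      absurd (hmax y (by simp [hp.ne_zero, hy0])) (not_le.2 hy)
    have h1 := eval_nonpos_of_root_of_im_div_nonneg hp hf hfp hfi ha0 hmax'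
    have h2 := eval_nonpos_of_root_of_im_div_nonneg hp hg hgp hgi ha0 hmax'
    have h3 : h.eval a ≤ 0 := by linarith [hsum a]
    obtain ⟨y, hy, hy0⟩ := hh.exists_root_ge_of_eval_nonpos h3
    exact hr y ((hx.trans_le (hmax x hmem)).trans_le hy) hy0
  by_contra! hcon
  obtain ⟨⟨x, hx, hx0⟩, ⟨y, hy, hy0⟩⟩ := hcon
  -- By monotonicity `f / p` and `g / p` are both nonpositive at the smaller of the two roots,
  -- whereas `h` is positive there.
  have hm : r < min x y := lt_min hx hy
  have hpm := hp.eval_pos_of_forall_root_le hpr hm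
  have h1 := monotoneOn_div_of_im_div_nonneg hfi hpr hm hx (min_le_left x y)
  have h2 := monotoneOn_div_of_im_div_nonneg hgi hpr hm hy (min_le_right x y)
  simp only [hx0, hy0, zero_div] at h1 h2
  rw [div_le_iff₀ hpm, zero_mul] at h1 h2
  have := hh.eval_pos_of_forall_root_le hr hm
  linarith [hsum (min x y)]

/-! ### Functions of determinant type on the matrix upper half-plane -/

section DetLike

open Matrix
open scoped ComplexOrder

/-- A square matrix lies in the matrix upper half-plane if its imaginary part is positive
definite. -/
def Matrix.IsUpper {n : Type*} (A : Matrix n n ℂ) : Prop :=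
  ∃ B C : Matrix n n ℂ, B.IsHermitian ∧ C.PosDef ∧ A = B + Complex.I • C

theorem Matrix.IsUpper.add_smul_vecMulVec {n : Type*} {A : Matrix n n ℂ} (hA : A.IsUpper)
    [Finite n] (v : n → ℂ) {z : ℂ} (hz : 0 ≤ z.im) :
    (A + z • vecMulVec v (star v)).IsUpper := by
  obtain ⟨B, C, hB, hC, rfl⟩ := hA
  have hv := posSemidef_vecMulVec_self_star v
  refine ⟨B + (z.re : ℂ) • vecMulVec v (star v), C + (z.im : ℂ) • vecMulVec v (star v),
    hB.add ?_, hC.add_posSemidef (hv.smul (by exact_mod_cast hz)), ?_⟩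
  · rw [IsHermitian, conjTranspose_smul, hv.isHermitian.eq]
    simp
  · conv_lhs => rw [← Complex.re_add_im z]
    module

theorem Matrix.IsUpper.sub_vecMulVec {n : Type*} {A : Matrix n n ℂ} (hA : A.IsUpper)
    [Finite n] (v : n → ℂ) : (A - vecMulVec v (star v)).IsUpper := by
  simpa [sub_eq_add_neg] using hA.add_smul_vecMulVec v (z := -1) (by simp)

theorem Matrix.IsHermitian.isUpper_smul_one_sub {n : Type*} [DecidableEq n] {B : Matrix n n ℂ}
    (hB : B.IsHermitian) {z : ℂ} (hz : 0 < z.im) : (z • (1 : Matrix n n ℂ) - B).IsUpper := by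
  refine ⟨(z.re : ℂ) • 1 - B, (z.im : ℂ) • 1, IsHermitian.sub ?_ hB,
    PosDef.one.smul (by exact_mod_cast hz), ?_⟩
  · simp [IsHermitian]
  · conv_lhs => rw [← Complex.re_add_im z]
    module

/-- For a kernel vector `x`, the number `xᴴ B x` is real, so the imaginary part of `xᴴ A x = 0`
would be `xᴴ C x > 0`. -/
theorem Matrix.IsUpper.det_ne_zero {n : Type*} [Fintype n] [DecidableEq n] {A : Matrix n n ℂ}
    (hA : A.IsUpper) : A.det ≠ 0 := by
  obtain ⟨B, C, hB, hC, rfl⟩ := hA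
  intro h
  obtain ⟨x, hx, hx0⟩ := exists_mulVec_eq_zero_iff.2 h
  have h1 : star x ⬝ᵥ (B *ᵥ x) + Complex.I * (star x ⬝ᵥ (C *ᵥ x)) = 0 := by
    simpa [add_mulVec, smul_mulVec] using congrArg (fun y => star x ⬝ᵥ y) hx0
  have h2 := hB.im_star_dotProduct_mulVec_self x
  have h3 := (Complex.lt_def.1 (hC.dotProduct_mulVec_pos hx)).1
  have h4 := congrArg Complex.im h1
  simp at h2 h3 h4
  linarith

/-- Functions that share with the determinant the properties used for the interlacing argument:
they do not vanish on the matrix upper half-plane, are affine there in the direction of rank one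
matrices, and restrict to monic real polynomials on the lines `z ↦ z - B` for Hermitian `B`. -/
structure IsDetLike {n : Type*} [Fintype n] [DecidableEq n] (F : Matrix n n ℂ → ℂ) : Prop where
  ne_zero : ∀ {A}, A.IsUpper → F A ≠ 0
  affine : ∀ {A}, A.IsUpper → ∀ v : n → ℂ,
    ∃ L, ∀ z : ℂ, F (A + z • vecMulVec v (star v)) = F A + z * L
  exists_poly : ∀ {B : Matrix n n ℂ}, B.IsHermitian → ∃ p : Polynomial ℝ, p.Monic ∧
    p.natDegree = Fintype.card n ∧ ∀ z : ℂ, F (z • 1 - B) = Polynomial.aeval z p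

theorem isDetLike_det {n : Type*} [Fintype n] [DecidableEq n] :
    IsDetLike (fun A : Matrix n n ℂ => A.det) where
  ne_zero hA := hA.det_ne_zero
  affine {A} hA v := by
    have hu : IsUnit A.det := hA.det_ne_zero.isUnit
    refine ⟨A.det * (replicateRow Unit (star v) * A⁻¹ * replicateCol Unit v) () (), fun z => ?_⟩
    have h1 : z • vecMulVec v (star v) =
        replicateCol Unit (z • v) * replicateRow Unit (star v) := by
      rw [← vecMulVec_eq, smul_vecMulVec]
    have h2 : replicateCol Unit (z • v) = z • replicateCol Unit v := by
      ext; simp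
    rw [h1, det_add_replicateCol_mul_replicateRow hu, h2, Matrix.mul_smul,
      det_unique (n := Unit)]
    simp
    ring
  exists_poly {B} hB := by
    refine ⟨∏ i, (Polynomial.X - Polynomial.C (hB.eigenvalues i)),
      Polynomial.monic_prod_X_sub_C _ _, by simp, fun z => ?_⟩
    have h := congrArg (Polynomial.eval z) hB.charpoly_eq
    rw [eval_charpoly, scalar_apply, ← smul_one_eq_diagonal] at h
    rw [h]
    simp [Polynomial.eval_prod]

namespace IsDetLike

variable {n : Type*} {F : Matrix n n ℂ → ℂ}

theorem sub_vecMulVec_eq {A : Matrix n n ℂ} {v : n → ℂ} {L : ℂ}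
    (hL : ∀ z : ℂ, F (A + z • vecMulVec v (star v)) = F A + z * L) :
    F (A - vecMulVec v (star v)) = F A - L := by
  simpa [sub_eq_add_neg] using hL (-1)

variable [Fintype n] [DecidableEq n]

/-- If `L ≠ 0`, the affine function `F A + z L` vanishes at `-F A / L`. This point cannot lie in the
closed upper half-plane, where `A + z v vᴴ` is still upper. -/
theorem slope_eq_zero_or_im_div_neg (hF : IsDetLike F) {A : Matrix n n ℂ} (hA : A.IsUpper)
    {v : n → ℂ} {L : ℂ} (hL : ∀ z : ℂ, F (A + z • vecMulVec v (star v)) = F A + z * L) :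
    L = 0 ∨ (L / F A).im < 0 := by
  by_cases hL0 : L = 0
  · exact Or.inl hL0
  right
  have hz : (-F A / L).im < 0 := by
    by_contra hneg
    refine hF.ne_zero (hA.add_smul_vecMulVec v (not_lt.1 hneg)) ?_
    rw [hL]
    field_simp
    ring
  have hFA := hF.ne_zero hA
  have : L / F A = -(-F A / L)⁻¹ := by
    field_simp
  rw [this, Complex.neg_im, Complex.inv_im, neg_div, neg_neg]
  exact div_neg_of_neg_of_pos hz (Complex.normSq_pos.2 (div_ne_zero (neg_ne_zero.2 hFA) hL0))

theorem im_div_nonneg (hF : IsDetLike F) {A : Matrix n n ℂ} (hA : A.IsUpper) (v : n → ℂ) :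
    0 ≤ (F (A - vecMulVec v (star v)) / F A).im := by
  obtain ⟨L, hL⟩ := hF.affine hA v
  rw [sub_vecMulVec_eq hL, sub_div, div_self (hF.ne_zero hA)]
  rcases hF.slope_eq_zero_or_im_div_neg hA hL with rfl | h
  · simp
  · simpa using h.le

theorem average (hF : IsDetLike F) (v w : n → ℂ) :
    IsDetLike fun A => (F (A - vecMulVec v (star v)) + F (A - vecMulVec w (star w))) / 2 where
  ne_zero {A} hA := by
    obtain ⟨L, hL⟩ := hF.affine hA v
    obtain ⟨M, hM⟩ := hF.affine hA w
    have hFA := hF.ne_zero hA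
    rw [sub_vecMulVec_eq hL, sub_vecMulVec_eq hM]
    intro h
    -- Each quotient is zero or has negative imaginary part, so the sum cannot be `2`.
    have h1 : L / F A + M / F A = 2 := by
      field_simp
      linear_combination -2 * h
    have h2 := congrArg Complex.im h1
    have h3 := hF.slope_eq_zero_or_im_div_neg hA hL
    have h4 := hF.slope_eq_zero_or_im_div_neg hA hM
    rcases h3 with rfl | h3 <;> rcases h4 with rfl | h4 <;> simp at h1 h2 <;> linarith
  affine {A} hA u := by
    obtain ⟨L, hL⟩ := hF.affine (hA.sub_vecMulVec v) u
    obtain ⟨M, hM⟩ := hF.affine (hA.sub_vecMulVec w) u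
    refine ⟨(L + M) / 2, fun z => ?_⟩
    rw [add_sub_right_comm, hL, add_sub_right_comm, hM]
    ring
  exists_poly {B} hB := by
    have key : ∀ u : n → ℂ, ∃ p : Polynomial ℝ, p.Monic ∧ p.natDegree = Fintype.card n ∧
        ∀ z : ℂ, F (z • 1 - B - vecMulVec u (star u)) = Polynomial.aeval z p := by
      intro u
      simp_rw [sub_sub]
      exact hF.exists_poly (hB.add (posSemidef_vecMulVec_self_star u).isHermitian)
    obtain ⟨p, hp, hpd, hpe⟩ := key v
    obtain ⟨q, hq, hqd, hqe⟩ := key w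
    have hp1 : p.coeff (Fintype.card n) = 1 := by rw [← hpd]; exact hp
    have hq1 : q.coeff (Fintype.card n) = 1 := by rw [← hqd]; exact hq
    have hle : (Polynomial.C (1 / 2 : ℝ) * (p + q)).natDegree ≤ Fintype.card n :=
      (Polynomial.natDegree_C_mul_le _ _).trans
        (Polynomial.natDegree_add_le_of_degree_le hpd.le hqd.le)
    have hc : (Polynomial.C (1 / 2 : ℝ) * (p + q)).coeff (Fintype.card n) = 1 := by
      rw [Polynomial.coeff_C_mul, Polynomial.coeff_add, hp1, hq1]
      norm_num
    refine ⟨_, Polynomial.monic_of_natDegree_le_of_coeff_eq_one _ hle hc,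
      le_antisymm hle (Polynomial.le_natDegree_of_ne_zero (by rw [hc]; exact one_ne_zero)),
      fun z => ?_⟩
    rw [hpe, hqe]
    simp
    ring

end IsDetLike

end DetLike

/-! ### Averaging over sign patterns and choosing one -/

section SignedSums

open Matrix
open scoped ComplexOrder

/-- Flipping the coordinate `e` is a bijection on patterns, so the terms with `s e` and with `!s e`
have equal sums. This conditions the average on one sign. -/
theorem Finset.sum_bool_functions {ι M : Type*} [Fintype ι] [DecidableEq ι] [AddCommMonoid M]
    (e : ι) (φ : Bool → (ι → Bool) → M)
    (hφ : ∀ b s c, φ b (Function.update s e c) = φ b s) :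
    (∑ s : ι → Bool, φ (s e) s) + ∑ s : ι → Bool, φ (s e) s =
      ∑ s : ι → Bool, φ true s + ∑ s : ι → Bool, φ false s := by
  have hflip : ∑ s : ι → Bool, φ (s e) s = ∑ s : ι → Bool, φ (!s e) s := by
    have hinv : Function.Involutive fun s : ι → Bool => Function.update s e (!s e) := by
      intro s
      simp
    rw [← Equiv.sum_comp hinv.toPerm]
    refine Finset.sum_congr rfl fun s _ => ?_
    simp [hφ]
  conv_lhs => rw [hflip]
  nth_rewrite 2 [← hflip]
  rw [← Finset.sum_add_distrib, ← Finset.sum_add_distrib]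
  refine Finset.sum_congr rfl fun s _ => ?_
  cases s e <;> simp [add_comm]

variable {n ι : Type*}

/-- The sum over `e ∈ S` of the rank one matrices `v vᴴ`, where `v = w e (s e)`. -/
def rankOneSum (w : ι → Bool → n → ℂ) (S : Finset ι) (s : ι → Bool) : Matrix n n ℂ :=
  ∑ e ∈ S, vecMulVec (w e (s e)) (star (w e (s e)))

theorem rankOneSum_update [DecidableEq ι] (w : ι → Bool → n → ℂ) {S : Finset ι} {e : ι}
    (he : e ∉ S) (s : ι → Bool) (b : Bool) :
    rankOneSum w S (Function.update s e b) = rankOneSum w S s := by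
  refine Finset.sum_congr rfl fun f hf => ?_
  rw [Function.update_of_ne (ne_of_mem_of_not_mem hf he)]

theorem rankOneSum_isHermitian (w : ι → Bool → n → ℂ) (S : Finset ι) (s : ι → Bool) :
    (rankOneSum w S s).IsHermitian := by
  rw [IsHermitian, rankOneSum, conjTranspose_sum]
  exact Finset.sum_congr rfl fun e _ => by simp [conjTranspose_vecMulVec]

variable [Fintype ι] [DecidableEq ι] [Fintype n] [DecidableEq n]

/-- The average of `det (A - rankOneSum w S s)` over all sign patterns `s`. -/
noncomputable def averageDet (w : ι → Bool → n → ℂ) (S : Finset ι) (A : Matrix n n ℂ) : ℂ :=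
  (∑ s : ι → Bool, (A - rankOneSum w S s).det) / 2 ^ Fintype.card ι

theorem averageDet_empty (w : ι → Bool → n → ℂ) :
    averageDet w ∅ = fun A : Matrix n n ℂ => A.det := by
  ext A
  simp [averageDet, rankOneSum]

theorem averageDet_insert (w : ι → Bool → n → ℂ) {S : Finset ι} {e : ι} (he : e ∉ S) :
    averageDet w (insert e S) = fun A : Matrix n n ℂ =>
      (averageDet w S (A - vecMulVec (w e true) (star (w e true))) +
        averageDet w S (A - vecMulVec (w e false) (star (w e false)))) / 2 := by
  ext A
  have h := Finset.sum_bool_functions e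
    (fun b s => (A - vecMulVec (w e b) (star (w e b)) - rankOneSum w S s).det)
    (fun b s c => by rw [rankOneSum_update w he])
  have h2 : ∑ s : ι → Bool, (A - rankOneSum w (insert e S) s).det =
      ∑ s : ι → Bool,
        (A - vecMulVec (w e (s e)) (star (w e (s e))) - rankOneSum w S s).det := by
    simp_rw [rankOneSum, Finset.sum_insert he, sub_sub]
  simp only [averageDet]
  rw [h2]
  field_simp
  linear_combination h

theorem isDetLike_averageDet (w : ι → Bool → n → ℂ) (S : Finset ι) :
    IsDetLike (averageDet w S) := by
  induction S using Finset.induction_on with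
  | empty => rw [averageDet_empty]; exact isDetLike_det
  | insert e S he ih => rw [averageDet_insert w he]; exact ih.average _ _

/-- The method of interlacing families: if all real roots of the averaged characteristic
polynomial are at most `r`, then some sign pattern attains this bound. -/
theorem exists_forall_det_ne_zero_of_averageDet (w : ι → Bool → n → ℂ) (S : Finset ι)
    {B : Matrix n n ℂ} (hB : B.IsHermitian) {r : ℝ}
    (hr : ∀ x : ℝ, r < x → averageDet w S ((x : ℂ) • 1 - B) ≠ 0) :
    ∃ s : ι → Bool, ∀ x : ℝ, r < x → ((x : ℂ) • 1 - B - rankOneSum w S s).det ≠ 0 := by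
  induction S using Finset.induction_on generalizing B with
  | empty =>
    rw [averageDet_empty] at hr
    exact ⟨fun _ => true, by simpa [rankOneSum] using hr⟩
  | insert e S he ih =>
    have hF := isDetLike_averageDet w S
    have hBv : ∀ b, (B + vecMulVec (w e b) (star (w e b))).IsHermitian := fun b =>
      hB.add (posSemidef_vecMulVec_self_star _).isHermitian
    -- `p` serves as common comparison polynomial for the two choices `f` and `g` at `e`, whose mean
    -- is `h`.
    obtain ⟨p, hp, hpd, hpe⟩ := hF.exists_poly hB
    obtain ⟨f, hf, hfd, hfe⟩ := hF.exists_poly (hBv true)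
    obtain ⟨g, hg, hgd, hge⟩ := hF.exists_poly (hBv false)
    obtain ⟨h, hh, hhd, hhe⟩ := (isDetLike_averageDet w (insert e S)).exists_poly hB
    have hreal : ∀ (q : Polynomial ℝ) (x : ℝ),
        Polynomial.aeval (x : ℂ) q = ((q.eval x : ℝ) : ℂ) := fun q x => by
      simpa using Polynomial.aeval_algebraMap_apply ℂ x q
    have him : ∀ (b : Bool) (q : Polynomial ℝ),
        (∀ z : ℂ, averageDet w S (z • 1 - (B + vecMulVec (w e b) (star (w e b)))) =
          Polynomial.aeval z q) →
        ∀ z : ℂ, 0 < z.im → 0 ≤ (Polynomial.aeval z q / Polynomial.aeval z p).im := by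
      intro b q hq z hz
      rw [← hq, ← hpe, ← sub_sub]
      exact hF.im_div_nonneg (hB.isUpper_smul_one_sub hz) _
    have hsum : ∀ x, f.eval x + g.eval x = 2 * h.eval x := by
      intro x
      have h1 := hhe x
      rw [averageDet_insert w he] at h1
      simp only [sub_sub] at h1
      rw [hfe, hge, hreal, hreal, hreal, div_eq_iff two_ne_zero] at h1
      rw [mul_comm]
      exact_mod_cast h1
    have hhr : ∀ x, r < x → h.eval x ≠ 0 := fun x hx h0 =>
      hr x hx (by rw [hhe, hreal, h0, Complex.ofReal_zero])
    have step : ∀ (b : Bool) (q : Polynomial ℝ),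
        (∀ z : ℂ, averageDet w S (z • 1 - (B + vecMulVec (w e b) (star (w e b)))) =
          Polynomial.aeval z q) →
        (∀ x, r < x → q.eval x ≠ 0) →
        ∃ s : ι → Bool, ∀ x : ℝ, r < x →
          ((x : ℂ) • 1 - B - rankOneSum w (insert e S) s).det ≠ 0 := by
      intro b q hq hqr
      obtain ⟨s, hs⟩ := ih (hBv b) fun x hx => by
        rw [hq, hreal]
        exact_mod_cast hqr x hx
      -- The inductive pattern does not control its value at `e ∉ S`, which may be overwritten
      -- freely.
      refine ⟨Function.update s e b, fun x hx => ?_⟩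
      have h1 : rankOneSum w (insert e S) (Function.update s e b) =
          vecMulVec (w e b) (star (w e b)) + rankOneSum w S s := by
        rw [← rankOneSum_update w he s b, rankOneSum, Finset.sum_insert he, Function.update_self]
        rfl
      rw [h1, sub_sub, ← add_assoc, ← sub_sub]
      exact hs x hx
    rcases forall_root_le_or_of_add hp hf hg (hfd.trans hpd.symm) (hgd.trans hpd.symm)
      (him true f hfe) (him false g hge) hh hsum hhr with hc | hc
    · exact step true f hfe hc
    · exact step false g hge hc

end SignedSums

/-! ### Matchings, involutions and the averaged characteristic polynomial -/

section Matchings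

variable {V : Type*} [Fintype V]

open Classical in
/-- The set of all matchings of `G`. -/
noncomputable def SimpleGraph.matchingFinset (G : SimpleGraph V) : Finset (Finset (Sym2 V)) :=
  Finset.univ.filter fun M : Finset (Sym2 V) =>
    (∀ e ∈ M, e ∈ G.edgeSet) ∧ ∀ e ∈ M, ∀ f ∈ M, e ≠ f → ∀ v, v ∈ e → v ∉ f

theorem matchingCount_eq_card_filter (G : SimpleGraph V) (k : ℕ) :
    matchingCount G k = (G.matchingFinset.filter fun M => M.card = k).card := by
  classical
  rw [matchingCount, SimpleGraph.matchingFinset, Finset.filter_filter]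
  congr 1
  ext M
  simp only [Finset.mem_filter, Finset.mem_univ, true_and]
  tauto

theorem SimpleGraph.eq_of_mem_matchingFinset {G : SimpleGraph V} {M : Finset (Sym2 V)}
    (hM : M ∈ G.matchingFinset) {a b c : V} (hb : s(a, b) ∈ M) (hc : s(a, c) ∈ M) : b = c := by
  simp only [matchingFinset, Finset.mem_filter, Finset.mem_univ, true_and] at hM
  by_contra hbc
  exact hM.2 _ hb _ hc (fun h => hbc (Sym2.congr_right.1 h)) a (by simp) (by simp)

/-- A permutation moving `i` along a cycle of length at least three cannot use only edges of an
acyclic graph on this cycle. -/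
theorem SimpleGraph.IsAcyclic.exists_not_adj_perm {T : SimpleGraph V} (hT : T.IsAcyclic)
    {π : Equiv.Perm V} {i : V} (hi : π (π i) ≠ i) :
    ∃ j, π (π j) ≠ j ∧ ¬ T.Adj j (π j) := by
  by_contra! hcon
  have hmove : ∀ m : ℕ, π (π ((π ^ m) i)) ≠ (π ^ m) i := by
    intro m h
    apply hi
    have : (π ^ m) (π (π i)) = (π ^ m) i := by
      rw [← h]
      exact congrArg (fun τ : Equiv.Perm V => τ i) (show π ^ m * (π * π) = π * (π * π ^ m) by
        rw [← mul_assoc, ← pow_succ, ← pow_succ, ← pow_succ', ← pow_succ'])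
    exact (π ^ m).injective this
  -- The orbit of `i` would lead from `π i` back to `i` without crossing the bridge `{i, π i}`.
  have hbridge := isAcyclic_iff_forall_isBridge.1 hT ((mem_edgeSet T).2 (hcon i hi))
  rw [isBridge_iff] at hbridge
  have hreach : ∀ m : ℕ, (T.deleteEdges {s(i, π i)}).Reachable (π i) ((π ^ (m + 1)) i) := by
    intro m
    induction m with
    | zero => simp
    | succ m ih =>
      refine ih.trans (Adj.reachable ?_)
      rw [pow_succ' π (m + 1), Equiv.Perm.mul_apply, deleteEdges_adj]
      refine ⟨hcon _ (hmove (m + 1)), fun h => ?_⟩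
      rw [Set.mem_singleton_iff, Sym2.eq_iff] at h
      -- A crossing means that the orbit has already reached `i`, or that `π (π i) = i`.
      rcases h with ⟨h, _⟩ | ⟨h, h'⟩
      · rw [h] at ih
        exact hbridge ih.symm
      · rw [h] at h'
        exact hi h'
  refine hbridge (Reachable.symm ?_)
  have := hreach (orderOf π - 1)
  rwa [Nat.sub_add_cancel (orderOf_pos π), pow_orderOf_eq_one] at this

variable [DecidableEq V]

open Classical in
/-- The involutions of `V` that move vertices only along edges of `G`. -/
noncomputable def SimpleGraph.edgeInvolutions (G : SimpleGraph V) : Finset (Equiv.Perm V) :=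
  Finset.univ.filter fun π => Function.Involutive π ∧ ∀ v, π v ≠ v → G.Adj v (π v)

/-- The set of transposed pairs of an involution. -/
def Equiv.Perm.movedPairs (π : Equiv.Perm V) : Finset (Sym2 V) :=
  π.support.image fun v => s(v, π v)

theorem Equiv.Perm.mk_mem_movedPairs {π : Equiv.Perm V} (hπ : Function.Involutive π) {a b : V} :
    s(a, b) ∈ π.movedPairs ↔ a ≠ b ∧ π a = b := by
  simp only [movedPairs, Finset.mem_image, Equiv.Perm.mem_support, Sym2.eq_iff]
  constructor
  · rintro ⟨v, hv, ⟨rfl, rfl⟩ | ⟨rfl, rfl⟩⟩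
    · exact ⟨hv.symm, rfl⟩
    · exact ⟨hv, hπ v⟩
  · rintro ⟨hab, rfl⟩
    exact ⟨a, hab.symm, Or.inl ⟨rfl, rfl⟩⟩

theorem Equiv.Perm.card_movedPairs {π : Equiv.Perm V} (hπ : Function.Involutive π) :
    π.support.card = 2 * π.movedPairs.card := by
  rw [Finset.card_eq_sum_card_image (fun v => s(v, π v)) π.support, mul_comm]
  refine Finset.sum_const_nat fun e he => ?_
  obtain ⟨v, hv, rfl⟩ := Finset.mem_image.1 he
  rw [Equiv.Perm.mem_support] at hv
  rw [Finset.card_eq_two]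
  refine ⟨v, π v, hv.symm, ?_⟩
  ext w
  simp only [Finset.mem_filter, Equiv.Perm.mem_support, Sym2.eq_iff, Finset.mem_insert,
    Finset.mem_singleton]
  constructor
  · rintro ⟨_, ⟨h, _⟩ | ⟨h, _⟩⟩ <;> simp [h]
  · rintro (rfl | rfl)
    · exact ⟨hv, Or.inl ⟨rfl, rfl⟩⟩
    · exact ⟨by rw [hπ v]; exact hv.symm, Or.inr ⟨rfl, hπ v⟩⟩

theorem Equiv.Perm.sign_eq_of_involutive {π : Equiv.Perm V} (hπ : Function.Involutive π) :
    Equiv.Perm.sign π = (-1) ^ π.movedPairs.card := by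
  have h2 : π ^ 2 = 1 := by
    ext v
    simpa [sq] using hπ v
  rw [Equiv.Perm.sign_of_pow_two_eq_one h2, Equiv.Perm.card_fixedPoints,
    Nat.sub_sub_self π.sum_cycleType_le, Equiv.Perm.sum_cycleType,
    Equiv.Perm.card_movedPairs hπ, Nat.mul_div_cancel_left _ two_pos]

theorem SimpleGraph.movedPairs_mem_matchingFinset {G : SimpleGraph V} {π : Equiv.Perm V}
    (hπ : π ∈ G.edgeInvolutions) : π.movedPairs ∈ G.matchingFinset := by
  simp only [edgeInvolutions, matchingFinset, Finset.mem_filter, Finset.mem_univ,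
    true_and] at hπ ⊢
  obtain ⟨hinv, hadj⟩ := hπ
  constructor
  · rintro ⟨a, b⟩ h
    obtain ⟨hab, rfl⟩ := (Equiv.Perm.mk_mem_movedPairs hinv).1 h
    exact hadj a hab.symm
  · intro e he f hf hef v hve hvf
    obtain ⟨a, rfl⟩ := hve
    obtain ⟨b, rfl⟩ := hvf
    have h1 := ((Equiv.Perm.mk_mem_movedPairs hinv).1 he).2
    have h2 := ((Equiv.Perm.mk_mem_movedPairs hinv).1 hf).2
    exact hef (by rw [← h1, ← h2])

theorem SimpleGraph.exists_edgeInvolution {G : SimpleGraph V} {M : Finset (Sym2 V)}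
    (hM : M ∈ G.matchingFinset) : ∃ π ∈ G.edgeInvolutions, π.movedPairs = M := by
  classical
  have hadj : ∀ {a b}, s(a, b) ∈ M → G.Adj a b := by
    intro a b h
    simp only [matchingFinset, Finset.mem_filter, Finset.mem_univ, true_and] at hM
    exact hM.1 _ h
  let p : V → V := fun v => if h : ∃ w, s(v, w) ∈ M then h.choose else v
  have hp : ∀ {a b}, s(a, b) ∈ M → p a = b := by
    intro a b h
    have hex : ∃ w, s(a, w) ∈ M := ⟨b, h⟩
    simp only [p, dif_pos hex]
    exact eq_of_mem_matchingFinset hM hex.choose_spec h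
  have hp' : ∀ {a}, p a ≠ a → s(a, p a) ∈ M := by
    intro a ha
    by_cases hex : ∃ w, s(a, w) ∈ M
    · obtain ⟨w, hw⟩ := hex
      rwa [hp hw]
    · simp [p, dif_neg hex] at ha
  have hinv : Function.Involutive p := by
    intro a
    by_cases ha : p a = a
    · rw [ha, ha]
    · exact hp (Sym2.eq_swap ▸ hp' ha)
  refine ⟨hinv.toPerm, ?_, ?_⟩
  · simp only [edgeInvolutions, Finset.mem_filter, Finset.mem_univ, true_and]
    exact ⟨hinv, fun v hv => hadj (hp' hv)⟩
  · ext ⟨a, b⟩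
    refine (Equiv.Perm.mk_mem_movedPairs (π := hinv.toPerm) hinv).trans ⟨?_, ?_⟩
    · rintro ⟨hab, rfl⟩
      exact hp' hab.symm
    · intro h
      exact ⟨(hadj h).ne, hp h⟩

/-- `Equiv.Perm.movedPairs` is a bijection from involutions along edges to matchings; the support
has twice as many elements as the matching, whence the range of `k`. -/
theorem SimpleGraph.sum_edgeInvolutions {R : Type*} [AddCommMonoid R] (G : SimpleGraph V)
    (f : ℕ → R) :
    ∑ π ∈ G.edgeInvolutions, f π.movedPairs.card =
      ∑ k ∈ Finset.range (Fintype.card V / 2 + 1), matchingCount G k • f k := by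
  classical
  have hbij : ∑ π ∈ G.edgeInvolutions, f π.movedPairs.card =
      ∑ M ∈ G.matchingFinset, f M.card := by
    refine Finset.sum_bij (fun π _ => π.movedPairs)
      (fun π hπ => movedPairs_mem_matchingFinset hπ) ?_ ?_ (fun _ _ => rfl)
    · intro π hπ τ hτ h
      simp only [edgeInvolutions, Finset.mem_filter, Finset.mem_univ, true_and] at hπ hτ
      have key : ∀ {π τ : Equiv.Perm V}, Function.Involutive π → Function.Involutive τ →
          π.movedPairs = τ.movedPairs → ∀ v, π v ≠ v → τ v = π v := by
        intro π τ hπ hτ h v hv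
        have := (Equiv.Perm.mk_mem_movedPairs hπ).2 ⟨hv.symm, rfl⟩
        rw [h] at this
        exact ((Equiv.Perm.mk_mem_movedPairs hτ).1 this).2
      ext v
      by_cases h1 : π v = v
      · by_cases h2 : τ v = v
        · rw [h1, h2]
        · exact key hτ.1 hπ.1 h.symm v h2
      · exact (key hπ.1 hτ.1 h v h1).symm
    · intro M hM
      obtain ⟨π, hπ, h⟩ := exists_edgeInvolution hM
      exact ⟨π, hπ, h⟩
  have hmaps : ∀ M ∈ G.matchingFinset, M.card ∈ Finset.range (Fintype.card V / 2 + 1) := by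
    intro M hM
    obtain ⟨π, hπ, rfl⟩ := exists_edgeInvolution hM
    simp only [edgeInvolutions, Finset.mem_filter, Finset.mem_univ, true_and] at hπ
    have h1 := Equiv.Perm.card_movedPairs hπ.1
    have h2 := π.support.card_le_univ
    rw [Finset.mem_range]
    omega
  rw [hbij, ← Finset.sum_fiberwise_of_maps_to hmaps]
  refine Finset.sum_congr rfl fun k _ => ?_
  rw [matchingCount_eq_card_filter, ← Finset.sum_const]
  exact Finset.sum_congr rfl fun M hM => by rw [(Finset.mem_filter.1 hM).2]

/-- The contribution of an involution along edges to the characteristic polynomial. -/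
theorem prod_smul_one_sub_of_mem_edgeInvolutions {R : Type*} [CommRing R] {G : SimpleGraph V}
    {H : Matrix V V R} (h0 : ∀ a, H a a = 0) (h1 : ∀ a b, G.Adj a b → H a b * H b a = 1)
    {π : Equiv.Perm V} (hπ : π ∈ G.edgeInvolutions) (x : R) :
    ∏ v, (x • (1 : Matrix V V R) - H) (π v) v =
      x ^ (Fintype.card V - 2 * π.movedPairs.card) := by
  simp only [SimpleGraph.edgeInvolutions, Finset.mem_filter, Finset.mem_univ, true_and] at hπ
  obtain ⟨hinv, hadj⟩ := hπ
  rw [← Finset.prod_mul_prod_compl π.support]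
  have hfix : ∏ v ∈ π.supportᶜ, (x • (1 : Matrix V V R) - H) (π v) v =
      x ^ (Fintype.card V - 2 * π.movedPairs.card) := by
    rw [← Equiv.Perm.card_movedPairs hinv, ← Finset.card_compl, ← Finset.prod_const]
    refine Finset.prod_congr rfl fun v hv => ?_
    have : π v = v := by simpa using hv
    simp [this, h0]
  have hmoved : ∏ v ∈ π.support, (x • (1 : Matrix V V R) - H) (π v) v = 1 := by
    -- The factors at `v` and `π v` are `-H (π v) v` and `-H v (π v)`, with product `1`.
    refine Finset.prod_involution (fun v _ => π v) ?_ ?_ ?_ ?_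
    · intro v hv
      have hv' : π v ≠ v := by simpa using hv
      have := h1 _ _ (hadj v hv')
      simp only [hinv v, Matrix.sub_apply, Matrix.smul_apply, Matrix.one_apply_ne hv',
        Matrix.one_apply_ne hv'.symm]
      simpa [mul_comm] using this
    · intro v hv _
      simpa using hv
    · intro v hv
      simpa using hv
    · intro v hv
      exact hinv v
  rw [hmoved, one_mul, hfix]

/-- Averaging the characteristic polynomial over all signings of the edges outside an acyclic
graph gives the matching polynomial. -/
theorem sum_det_eq_matchingPolynomial {G T : SimpleGraph V} (hT : T.IsAcyclic)
    (H : (Sym2 V → Bool) → Matrix V V ℂ)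
    (h0 : ∀ s a b, ¬ G.Adj a b → H s a b = 0)
    (h1 : ∀ s a b, G.Adj a b → H s a b * H s b a = 1)
    (hupdate : ∀ s e a b, s(a, b) ≠ e → H (Function.update s e (!s e)) a b = H s a b)
    (hflip : ∀ s a b, ¬ T.Adj a b →
      H (Function.update s s(a, b) (!s s(a, b))) a b = -H s a b) (x : ℂ) :
    (∑ s : Sym2 V → Bool, (x • (1 : Matrix V V ℂ) - H s).det) / 2 ^ Fintype.card (Sym2 V) =
      Polynomial.aeval x (matchingPolynomial G) := by
  classical
  have hzero : ∀ π : Equiv.Perm V, π ∉ G.edgeInvolutions →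
      ∑ s : Sym2 V → Bool, ∏ v, (x • (1 : Matrix V V ℂ) - H s) (π v) v = 0 := by
    intro π hπ
    by_cases hadj : ∀ v, π v ≠ v → G.Adj v (π v)
    · have hinv : ¬ Function.Involutive π := fun h => hπ (by
        simp only [SimpleGraph.edgeInvolutions, Finset.mem_filter, Finset.mem_univ, true_and]
        exact ⟨h, hadj⟩)
      simp only [Function.Involutive, not_forall] at hinv
      obtain ⟨i, hi⟩ := hinv
      obtain ⟨j, hj, hjT⟩ := hT.exists_not_adj_perm hi
      have hjπ : π j ≠ j := fun h => hj (by rw [h, h])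
      set e := s(π j, j) with he
      have hflipInv : Function.Involutive
          fun s : Sym2 V → Bool => Function.update s e (!s e) := fun s => by simp
      have hneg : ∀ s : Sym2 V → Bool,
          ∏ v, (x • (1 : Matrix V V ℂ) - H (Function.update s e (!s e))) (π v) v =
            -∏ v, (x • (1 : Matrix V V ℂ) - H s) (π v) v := by
        intro s
        rw [← Finset.mul_prod_erase _ _ (Finset.mem_univ j),
          ← Finset.mul_prod_erase _ (fun v => (x • (1 : Matrix V V ℂ) - H s) (π v) v)
            (Finset.mem_univ j), ← neg_mul]
        congr 1
        · simp only [Matrix.sub_apply, Matrix.smul_apply, Matrix.one_apply_ne hjπ]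
          rw [hflip s (π j) j (fun h => hjT h.symm)]
          simp
        -- The pair `e` could occur again only at `v = π j` with `π v = j`, which `hj` excludes; so
        -- exactly one factor changes sign.
        · refine Finset.prod_congr rfl fun v hv => ?_
          have hvj : v ≠ j := Finset.ne_of_mem_erase hv
          rw [Matrix.sub_apply, Matrix.sub_apply, hupdate]
          rw [he, Ne, Sym2.eq_iff]
          rintro (⟨_, h⟩ | ⟨h, h'⟩)
          · exact hvj h
          · rw [h'] at h
            exact hj h
      have hself := Equiv.sum_comp hflipInv.toPerm
        fun s => ∏ v, (x • (1 : Matrix V V ℂ) - H s) (π v) v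
      simp only [Function.Involutive.coe_toPerm, hneg, Finset.sum_neg_distrib] at hself
      exact self_eq_neg.1 hself.symm
    · push Not at hadj
      obtain ⟨v, hv, hvG⟩ := hadj
      refine Finset.sum_eq_zero fun s _ => Finset.prod_eq_zero (Finset.mem_univ v) ?_
      rw [Matrix.sub_apply, h0 s _ _ (fun h => hvG h.symm), Matrix.smul_apply,
        Matrix.one_apply_ne hv]
      simp
  have hone : ∀ π ∈ G.edgeInvolutions,
      ∑ s : Sym2 V → Bool, ∏ v, (x • (1 : Matrix V V ℂ) - H s) (π v) v =
        2 ^ Fintype.card (Sym2 V) * x ^ (Fintype.card V - 2 * π.movedPairs.card) := by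
    intro π hπ
    rw [Finset.sum_congr rfl fun s _ => prod_smul_one_sub_of_mem_edgeInvolutions
      (fun a => h0 s a a (G.loopless.irrefl a)) (h1 s) hπ x]
    simp
  have hdet : ∑ s : Sym2 V → Bool, (x • (1 : Matrix V V ℂ) - H s).det =
      ∑ π ∈ G.edgeInvolutions, 2 ^ Fintype.card (Sym2 V) *
        ((-1) ^ π.movedPairs.card * x ^ (Fintype.card V - 2 * π.movedPairs.card)) := by
    simp_rw [Matrix.det_apply']
    rw [Finset.sum_comm]
    simp_rw [← Finset.mul_sum]
    rw [← Finset.sum_subset (Finset.subset_univ G.edgeInvolutions)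
      (fun π _ hπ => by rw [hzero π hπ, mul_zero]), Finset.mul_sum]
    refine Finset.sum_congr rfl fun π hπ => ?_
    rw [hone π hπ, Equiv.Perm.sign_eq_of_involutive (by
      simp only [SimpleGraph.edgeInvolutions, Finset.mem_filter] at hπ
      exact hπ.2.1)]
    push_cast
    ring
  rw [hdet, ← Finset.mul_sum, mul_div_cancel_left₀ _ (pow_ne_zero _ two_ne_zero), G.sum_edgeInvolutions
    fun k => (-1) ^ k * x ^ (Fintype.card V - 2 * k), matchingPolynomial, map_sum]
  refine Finset.sum_congr rfl fun k _ => ?_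
  simp
  ring

end Matchings

/-! ### Orientations as choices of rank one matrices -/

section SignedOrientations

variable {V : Type*}

theorem Sym2.out_eq_or (u v : V) :
    Quot.out s(u, v) = (u, v) ∨ Quot.out s(u, v) = (v, u) := by
  have h : s((Quot.out s(u, v)).1, (Quot.out s(u, v)).2) = s(u, v) := Quot.out_eq s(u, v)
  rw [Sym2.eq_iff] at h
  rcases h with ⟨h1, h2⟩ | ⟨h1, h2⟩
  · exact Or.inl (Prod.ext h1 h2)
  · exact Or.inr (Prod.ext h1 h2)

variable [DecidableEq V]

/-- The sign of the ordered pair `(u, v)` relative to a fixed reference direction of the pair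
`s(u, v)`, reversed if `s` is false on this pair. -/
noncomputable def pairSign (s : Sym2 V → Bool) (u v : V) : SignType :=
  if decide ((Quot.out s(u, v)).1 = u) = s s(u, v) then 1 else -1

theorem pairSign_swap (s : Sym2 V → Bool) {u v : V} (h : u ≠ v) :
    pairSign s u v = -pairSign s v u := by
  unfold pairSign
  rw [show s(v, u) = s(u, v) from Sym2.eq_swap]
  rcases Sym2.out_eq_or u v with ho | ho <;> cases s s(u, v) <;> simp [ho, h, h.symm]

theorem pairSign_ne_zero (s : Sym2 V → Bool) (u v : V) : pairSign s u v ≠ 0 := by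
  unfold pairSign
  split_ifs <;> decide

open Classical in
/-- The orientation of the edges of `G` outside `F` given by a sign pattern. -/
noncomputable def signedOrientation (G : SimpleGraph V) (F : Set (Sym2 V))
    (s : Sym2 V → Bool) : PartialOrientation G F where
  sign u v := if s(u, v) ∈ G.edgeSet \ F then pairSign s u v else 0
  skew u v := by
    rw [show s(v, u) = s(u, v) from Sym2.eq_swap]
    split_ifs with h
    · exact pairSign_swap s ((SimpleGraph.mem_edgeSet G).1 h.1).ne
    · simp
  ne_zero_iff u v := by
    split_ifs with h
    · simp [h, pairSign_ne_zero]
    · simp [h]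

/-- A vector `v` such that the off-diagonal entries of `v vᴴ` are those of an arc joining the
two members of `e`. -/
noncomputable def arcVector (e : Sym2 V) (b : Bool) : V → ℂ :=
  Pi.single (Quot.out e).1 1 + Pi.single (Quot.out e).2 (if b then -Complex.I else Complex.I)

theorem vecMulVec_arcVector_self (s : Sym2 V → Bool) {u v : V} (h : u ≠ v) :
    Matrix.vecMulVec (arcVector s(u, v) (s s(u, v))) (star (arcVector s(u, v) (s s(u, v)))) u v =
      Complex.I * ((pairSign s u v : SignType) : ℂ) := by
  unfold pairSign arcVector
  rcases Sym2.out_eq_or u v with ho | ho <;> cases s s(u, v) <;>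
    simp [ho, h, h.symm, Matrix.vecMulVec_apply]

theorem vecMulVec_arcVector_of_ne {e : Sym2 V} (b : Bool) {u v : V} (h : u ≠ v)
    (he : e ≠ s(u, v)) :
    Matrix.vecMulVec (arcVector e b) (star (arcVector e b)) u v = 0 := by
  induction e with | _ p q
  have h1 : ∀ a, a ≠ p → a ≠ q → arcVector s(p, q) b a = 0 := by
    intro a hp hq
    unfold arcVector
    rcases Sym2.out_eq_or p q with ho | ho <;> simp [ho, hp, hq]
  rw [Matrix.vecMulVec_apply, Pi.star_apply]
  by_cases hu : u = p ∨ u = q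
  · rw [h1 v, star_zero, mul_zero]
    · rintro rfl
      rcases hu with rfl | rfl
      · exact h rfl
      · exact he Sym2.eq_swap
    · rintro rfl
      rcases hu with rfl | rfl
      · exact he rfl
      · exact h rfl
  · push Not at hu
    rw [h1 u hu.1 hu.2, zero_mul]

/-- Changing `i` to `-i` preserves the modulus of every entry, so a single diagonal shift serves all
orientations. -/
theorem vecMulVec_arcVector_diag (e : Sym2 V) (b : Bool) (u : V) :
    Matrix.vecMulVec (arcVector e b) (star (arcVector e b)) u u =
      Matrix.vecMulVec (arcVector e true) (star (arcVector e true)) u u := by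
  cases b
  · simp only [arcVector, Matrix.vecMulVec_apply, Pi.star_apply, Pi.add_apply, Pi.single_apply]
    split_ifs <;> simp
    ring
  · rfl

variable [Fintype V]

/-- The edges of `G` outside `T`, as a finite set. -/
noncomputable def SimpleGraph.edgeFinsetOutside (G T : SimpleGraph V) : Finset (Sym2 V) :=
  (Set.toFinite (G.edgeSet \ T.edgeSet)).toFinset

open Classical in
/-- The part of the Hermitian adjacency matrix coming from the undirected edges, with the
diagonal shifted to compensate the rank one matrices of the arcs. -/
noncomputable def undirectedPart (G T : SimpleGraph V) : Matrix V V ℂ :=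
  Matrix.of fun u v =>
    if u = v then -rankOneSum arcVector (G.edgeFinsetOutside T) (fun _ => true) u u
    else if T.Adj u v then 1 else 0

theorem hermitianAdjMatrix_signedOrientation (G T : SimpleGraph V) (s : Sym2 V → Bool) :
    hermitianAdjMatrix (signedOrientation G T.edgeSet s) =
      undirectedPart G T + rankOneSum arcVector (G.edgeFinsetOutside T) s := by
  ext u v
  rw [Matrix.add_apply]
  by_cases huv : u = v
  · subst huv
    have h : rankOneSum arcVector (G.edgeFinsetOutside T) s u u =
        rankOneSum arcVector (G.edgeFinsetOutside T) (fun _ => true) u u := by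
      simp only [rankOneSum, Matrix.sum_apply]
      exact Finset.sum_congr rfl fun e _ => vecMulVec_arcVector_diag e _ u
    simp [undirectedPart, h, hermitianAdjMatrix]
  · have hz : ∀ e ∈ G.edgeFinsetOutside T, e ≠ s(u, v) →
        Matrix.vecMulVec (arcVector e (s e)) (star (arcVector e (s e))) u v = 0 :=
      fun e _ he => vecMulVec_arcVector_of_ne _ huv he
    have hmem : s(u, v) ∈ G.edgeFinsetOutside T ↔ G.Adj u v ∧ ¬ T.Adj u v := by
      simp [SimpleGraph.edgeFinsetOutside]
    rw [rankOneSum, Matrix.sum_apply]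
    by_cases hT : T.Adj u v
    · rw [Finset.sum_eq_zero fun e he =>
        hz e he (fun h => (hmem.1 (h ▸ he)).2 hT)]
      simp [hermitianAdjMatrix, undirectedPart, huv, hT]
    · by_cases hG : G.Adj u v
      · rw [Finset.sum_eq_single_of_mem _ (hmem.2 ⟨hG, hT⟩) hz, vecMulVec_arcVector_self s huv]
        simp [hermitianAdjMatrix, undirectedPart, huv, hT, hG, signedOrientation]
      · rw [Finset.sum_eq_zero fun e he =>
          hz e he (fun h => hG (hmem.1 (h ▸ he)).1)]
        simp [hermitianAdjMatrix, undirectedPart, huv, hT, hG]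

theorem undirectedPart_isHermitian (G T : SimpleGraph V) : (undirectedPart G T).IsHermitian := by
  rw [eq_sub_of_add_eq (hermitianAdjMatrix_signedOrientation G T fun _ => true).symm]
  exact (hermitianAdjMatrix_isHermitian _).sub (rankOneSum_isHermitian _ _ _)

/-- The matching polynomial is the average of the characteristic polynomials of the Hermitian
adjacency matrices over all orientations of the edges outside an acyclic subgraph. -/
theorem averageDet_eq_aeval_matchingPolynomial {G T : SimpleGraph V} (hTG : T ≤ G)
    (hT : T.IsAcyclic) (x : ℂ) :
    averageDet arcVector (G.edgeFinsetOutside T) (x • 1 - undirectedPart G T) =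
      Polynomial.aeval x (matchingPolynomial G) := by
  have hsub : ∀ s, x • 1 - undirectedPart G T - rankOneSum arcVector (G.edgeFinsetOutside T) s =
      x • 1 - hermitianAdjMatrix (signedOrientation G T.edgeSet s) := fun s => by
    rw [hermitianAdjMatrix_signedOrientation, sub_sub]
  simp only [averageDet, hsub]
  refine sum_det_eq_matchingPolynomial hT _ ?_ ?_ ?_ ?_ x
  · intro s a b h
    have hab : ¬ T.Adj a b := fun h' => h (hTG h')
    simp [hermitianAdjMatrix, h, hab]
  · intro s a b h
    by_cases hab : T.Adj a b
    · simp [hermitianAdjMatrix, hab, hab.symm]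
    · have hba : ¬ T.Adj b a := fun h' => hab h'.symm
      simp only [hermitianAdjMatrix, signedOrientation, Matrix.of_apply, Set.mem_sdiff,
        SimpleGraph.mem_edgeSet, h, h.symm, hab, hba, not_false_eq_true, and_self, if_true,
        if_false]
      rw [pairSign_swap s h.ne]
      unfold pairSign
      split_ifs <;> simp
  · intro s e a b he
    simp [hermitianAdjMatrix, signedOrientation, pairSign, Function.update_of_ne he]
  · intro s a b hab
    by_cases h : G.Adj a b
    · simp only [hermitianAdjMatrix, signedOrientation, Matrix.of_apply, Set.mem_sdiff,
        SimpleGraph.mem_edgeSet, h, hab, not_false_eq_true, and_self, if_true, if_false]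
      unfold pairSign
      rw [Function.update_self]
      cases s s(a, b) <;> by_cases ho : (Quot.out s(a, b)).1 = a <;> simp [ho]
    · simp [hermitianAdjMatrix, h, hab]

end SignedOrientations

/-! ### Real roots, parity and the main theorem -/

open Polynomial in
theorem exists_isGreatest_root {p : ℝ[X]} (hp : p.Monic) (hdeg : p.natDegree ≠ 0)
    (hreal : ∀ z : ℂ, aeval z p = 0 → z.im = 0) :
    ∃ r : ℝ, IsGreatest {x : ℝ | p.IsRoot x} r := by
  obtain ⟨z, hz⟩ := Complex.exists_root (f := p.map (algebraMap ℝ ℂ)) (by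
    rw [degree_map]
    exact natDegree_pos_iff_degree_pos.1 (Nat.pos_of_ne_zero hdeg))
  rw [IsRoot, eval_map_algebraMap] at hz
  have hzre : z = (z.re : ℂ) := Complex.ext rfl (by simp [hreal z hz])
  have hroot : p.IsRoot z.re := by
    rw [hzre] at hz
    have := aeval_algebraMap_apply ℂ z.re p
    rw [Complex.coe_algebraMap, hz] at this
    exact_mod_cast this.symm
  have hfin : {x : ℝ | p.IsRoot x}.Finite := p.finite_setOfPred_isRoot hp.ne_zero
  obtain ⟨r, hr, hmax⟩ := hfin.exists_maximalFor id _ ⟨z.re, hroot⟩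
  exact ⟨r, hr, fun x hx => (le_total x r).elim id fun h => hmax hx h⟩

/-- The upper half-plane is excluded by nonvanishing, the lower one by conjugating the root of a
real polynomial. -/
theorem IsDetLike.im_eq_zero_of_root {n : Type*} [Fintype n] [DecidableEq n]
    {F : Matrix n n ℂ → ℂ} (hF : IsDetLike F) {B : Matrix n n ℂ} (hB : B.IsHermitian)
    {p : Polynomial ℝ} (hp : ∀ z : ℂ, F (z • 1 - B) = Polynomial.aeval z p) (z : ℂ)
    (hz : Polynomial.aeval z p = 0) : z.im = 0 := by
  rcases lt_trichotomy z.im 0 with h | h | h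
  · refine absurd ?_ (hF.ne_zero (hB.isUpper_smul_one_sub
      (z := (starRingEnd ℂ) z) (by simpa using h)))
    rw [hp, Polynomial.aeval_conj, hz, map_zero]
  · exact h
  · exact absurd ((hp z).trans hz) (hF.ne_zero (hB.isUpper_smul_one_sub h))

theorem aeval_neg_matchingPolynomial {V : Type*} [Fintype V] (G : SimpleGraph V) (z : ℂ) :
    Polynomial.aeval (-z) (matchingPolynomial G) =
      (-1) ^ Fintype.card V * Polynomial.aeval z (matchingPolynomial G) := by
  simp only [matchingPolynomial, map_sum, Finset.mul_sum]
  refine Finset.sum_congr rfl fun k hk => ?_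
  have hk' : 2 * k ≤ Fintype.card V := by
    rw [Finset.mem_range] at hk
    omega
  have h : (-1 : ℂ) ^ Fintype.card V = (-1) ^ (Fintype.card V - 2 * k) := by
    conv_lhs => rw [← Nat.sub_add_cancel hk', pow_add, pow_mul]
    simp
  rw [h]
  simp only [map_mul, map_pow, Polynomial.aeval_X, Polynomial.aeval_C]
  rw [neg_pow z]
  ring

theorem mem_realEigenvalues_iff {V : Type*} [Fintype V] [DecidableEq V] (A : Matrix V V ℂ)
    (x : ℝ) : x ∈ realEigenvalues A ↔ ((x : ℂ) • 1 - A).det = 0 := by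
  rw [realEigenvalues, Set.mem_ofPred_eq, Module.End.hasEigenvalue_iff_isRoot_charpoly,
    Matrix.charpoly_toLin', Polynomial.IsRoot, Matrix.eval_charpoly, Matrix.scalar_apply,
    ← Matrix.smul_one_eq_diagonal]

theorem mainTheorem1 {V : Type*} [Fintype V] [DecidableEq V] (G T : SimpleGraph V)
    (hG : G.Connected) (hTG : T ≤ G) (hT : T.IsTree) :
    ∃ ρ : ℝ,
      IsGreatest {x : ℝ | (matchingPolynomial G).IsRoot x} ρ ∧
      IsGreatest {r : ℝ | ∃ z : ℂ, Polynomial.aeval z (matchingPolynomial G) = 0 ∧ r = ‖z‖} ρ ∧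
      ∃ σ : PartialOrientation G T.edgeSet, ∃ lam : ℝ,
        IsGreatest (realEigenvalues (hermitianAdjMatrix σ)) lam ∧ lam ≤ ρ := by
  -- Connectedness supplies a vertex, so the polynomials below have positive degree and hence a
  -- root.
  have hcard : Fintype.card V ≠ 0 := by
    have := hG.nonempty
    exact Fintype.card_ne_zero
  have hofReal : ∀ (q : Polynomial ℝ) (x : ℝ),
      Polynomial.aeval (x : ℂ) q = ((q.eval x : ℝ) : ℂ) := fun q x => by
    simpa using Polynomial.aeval_algebraMap_apply ℂ x q
  have hF := isDetLike_averageDet arcVector (G.edgeFinsetOutside T)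
  have hB := undirectedPart_isHermitian G T
  have haverage := averageDet_eq_aeval_matchingPolynomial hTG hT.isAcyclic
  -- Both facts are inherited from the averaged determinant, which agrees with the matching
  -- polynomial at every real point.
  obtain ⟨hmonic, hdeg⟩ : (matchingPolynomial G).Monic ∧
      (matchingPolynomial G).natDegree = Fintype.card V := by
    obtain ⟨p, hp, hpd, hpe⟩ := hF.exists_poly hB
    have : matchingPolynomial G = p := Polynomial.funext fun x => by
      have h := (haverage x).symm.trans (hpe x)
      rw [hofReal, hofReal] at h
      exact_mod_cast h
    exact this ▸ ⟨hp, hpd⟩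
  have him := hF.im_eq_zero_of_root hB haverage
  obtain ⟨ρ, hρ, hmax⟩ := exists_isGreatest_root hmonic (hdeg ▸ hcard) him
  have hroot : ∀ x : ℝ, Polynomial.aeval (x : ℂ) (matchingPolynomial G) = 0 → x ≤ ρ := by
    intro x hx
    rw [hofReal] at hx
    exact hmax (by exact_mod_cast hx)
  have hρ0 : Polynomial.aeval (ρ : ℂ) (matchingPolynomial G) = 0 := by
    rw [hofReal, show (matchingPolynomial G).eval ρ = 0 from hρ, Complex.ofReal_zero]
  -- The roots are symmetric about `0`, so `-ρ ≤ ρ`; the same symmetry bounds `|x|` by `ρ` for every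
  -- root `x`.
  have hnonneg : 0 ≤ ρ := by
    have := hroot (-ρ) (by rw [Complex.ofReal_neg, aeval_neg_matchingPolynomial, hρ0, mul_zero])
    linarith
  refine ⟨ρ, ⟨hρ, hmax⟩, ⟨⟨ρ, hρ0, ?_⟩, ?_⟩, ?_⟩
  · rw [Complex.norm_real, Real.norm_of_nonneg hnonneg]
  · rintro _ ⟨z, hz, rfl⟩
    have hzre : z = (z.re : ℂ) := Complex.ext rfl (by simp [him z hz])
    rw [hzre] at hz ⊢
    rw [Complex.norm_real, Real.norm_eq_abs]
    refine abs_le'.2 ⟨hroot _ hz, hroot _ ?_⟩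
    rw [Complex.ofReal_neg, aeval_neg_matchingPolynomial, hz, mul_zero]
  · obtain ⟨s, hs⟩ := exists_forall_det_ne_zero_of_averageDet arcVector
      (G.edgeFinsetOutside T) hB (r := ρ) fun x hx h =>
        absurd (hroot x ((haverage x).symm.trans h)) (not_le.2 hx)
    have hH := hermitianAdjMatrix_isHermitian (signedOrientation G T.edgeSet s)
    obtain ⟨p, hp, hpd, hpe⟩ := isDetLike_det.exists_poly hH
    obtain ⟨lam, hlam⟩ := exists_isGreatest_root hp (hpd ▸ hcard)
      (isDetLike_det.im_eq_zero_of_root hH hpe)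
    have hset : realEigenvalues (hermitianAdjMatrix (signedOrientation G T.edgeSet s)) =
        {x : ℝ | p.IsRoot x} := by
      ext x
      rw [mem_realEigenvalues_iff, hpe, hofReal, Complex.ofReal_eq_zero]
      rfl
    refine ⟨signedOrientation G T.edgeSet s, lam, hset ▸ hlam, ?_⟩
    by_contra hlt
    refine hs lam (not_le.1 hlt) ?_
    rw [sub_sub, ← hermitianAdjMatrix_signedOrientation, ← mem_realEigenvalues_iff, hset]
    exact hlam.1
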